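/- An exponent on $[0,1]$ is a real measurable function $p$ with $1\le p(t)<\infty$. For an exponent $p(\cdot)$, $L^{p(\cdot)}[0,1]$ is the space of (a.e. classes of) real measurable functions $f$ on $[0,1]$ such that $\rho_{p(\cdot)}(f/r)<\infty$ for some $r>0$, where $\rho_{p(\cdot)}(f)=\int_0^1|f(t)|^{p(t)}\,dt$, with the norm $\|f\|_{p(\cdot)}=\inf\{r>0:\rho_{p(\cdot)}(f/r)\le 1\}$ and the a.e. order. A bounded operator $T:E\to F$ from a Banach lattice $E$ to a Banach space $F$ is disjointly strictly singular (DSS) if for no normalized pairwise disjoint sequence $(f_n)$ in $E$ (that is, $|f_m|\wedge|f_n|=0$ for $m\ne n$) is the restriction of $T$ to the closed linear span $[f_n]$ an isomorphism onto its image. A function $f:[0,1]\to\mathbb R$ is log-Hölder continuous if there is a constant $C>0$ with $|f(x)-f(y)|\le C/\ln\left(e+\frac1{|x-y|}\right)$ for all $x\ne y$. The decreasing rearrangement of a measurable function $f$ on $[0,1]$ is $f^*(x)=\inf\{s\ge 0: |\{t\in[0,1]:|f(t)|>s\}|\le x\}$, $0\le x<1$, where $|\cdot|$ of a set is its Lebesgue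 measure. Corollary 5.3. Let $p(\cdot)$ and $q(\cdot)$ be log-Hölder continuous exponents on $[0,1]$ with $p(\cdot)\ge q(\cdot)$ almost everywhere and $p^+:=\operatorname{ess\,sup}p<\infty$. The following are equivalent: 1. $\operatorname{ess\,inf}(p-q)>0$; 2. the inclusion $L^{p(\cdot)}[0,1]\hookrightarrow L^{q(\cdot)}[0,1]$ is DSS; 3. $\lim_{x\to1^-}(1-x)^{(p-q)^*(x)}=0$. -/

import Mathlib

open MeasureTheory Filter Topology Set
open scoped ENNReal

/-- An exponent on `Ω`: a real measurable function `p` with `1 ≤ p t < ∞` for all `t`. -/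
structure Exponent (Ω : Type*) [MeasurableSpace Ω] where
  toFun : Ω → ℝ
  measurable' : Measurable toFun
  one_le' : ∀ t, 1 ≤ toFun t

namespace Exponent

instance {Ω : Type*} [MeasurableSpace Ω] : CoeFun (Exponent Ω) (fun _ => Ω → ℝ) := ⟨toFun⟩

end Exponent

noncomputable section

namespace VarLebesgue

/-- The modular `ρ_p(f) = ∫ |f(t)|^{p(t)} dμ`, with values in `[0, ∞]`. -/
def modular {Ω : Type*} [MeasurableSpace Ω] (p : Exponent Ω) (μ : Measure Ω) (f : Ω → ℝ) : ℝ≥0∞ :=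
  ∫⁻ t, ‖f t‖ₑ ^ p t ∂μ

section Modular

variable {Ω : Type*} [MeasurableSpace Ω] {p : Exponent Ω} {μ : Measure Ω}

theorem exponent_pos (p : Exponent Ω) (t : Ω) : 0 < p t := zero_lt_one.trans_le (p.one_le' t)

theorem modular_mono {f g : Ω → ℝ} (h : ∀ᵐ t ∂μ, |f t| ≤ |g t|) :
    modular p μ f ≤ modular p μ g := by
  refine lintegral_mono_ae (h.mono fun t ht => ?_)
  refine ENNReal.rpow_le_rpow ?_ (exponent_pos p t).le
  simpa [Real.enorm_eq_ofReal_abs] using ENNReal.ofReal_le_ofReal ht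

theorem modular_const_mul_le {f : Ω → ℝ} (hf : AEStronglyMeasurable f μ) {c : ℝ}
    (hc0 : 0 ≤ c) (hc : c ≤ 1) :
    modular p μ (fun t => c * f t) ≤ ENNReal.ofReal c * modular p μ f := by
  unfold modular
  rw [← lintegral_const_mul'' _ (hf.enorm.pow p.measurable'.aemeasurable)]
  refine lintegral_mono fun t => ?_
  rw [enorm_mul, ENNReal.mul_rpow_of_nonneg _ _ (exponent_pos p t).le,
    Real.enorm_eq_ofReal hc0]
  gcongr
  calc ENNReal.ofReal c ^ p t ≤ ENNReal.ofReal c ^ (1 : ℝ) :=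
        ENNReal.rpow_le_rpow_of_exponent_ge (by simpa using hc) (p.one_le' t)
    _ = ENNReal.ofReal c := ENNReal.rpow_one _

theorem modular_add_div_le {f g h : Ω → ℝ} (hf : AEStronglyMeasurable f μ)
    {r s : ℝ} (hr : 0 < r) (hs : 0 < s)
    (hfr : modular p μ (fun t => f t / r) ≤ 1) (hgs : modular p μ (fun t => g t / s) ≤ 1)
    (hh : ∀ᵐ t ∂μ, |h t| ≤ |f t| + |g t|) :
    modular p μ (fun t => h t / (r + s)) ≤ 1 := by
  have hrs : 0 < r + s := add_pos hr hs
  have hw : ENNReal.ofReal (r / (r + s)) + ENNReal.ofReal (s / (r + s)) = 1 := by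
    rw [← ENNReal.ofReal_add (by positivity) (by positivity), ← add_div, div_self hrs.ne',
      ENNReal.ofReal_one]
  have hm : AEMeasurable (fun t => ‖f t / r‖ₑ ^ p t) μ :=
    (hf.aemeasurable.div_const r).enorm.pow p.measurable'.aemeasurable
  calc modular p μ (fun t => h t / (r + s))
      ≤ ∫⁻ t, (ENNReal.ofReal (r / (r + s)) * ‖f t / r‖ₑ ^ p t
          + ENNReal.ofReal (s / (r + s)) * ‖g t / s‖ₑ ^ p t) ∂μ := by
        refine lintegral_mono_ae (hh.mono fun t ht => ?_)
        refine le_trans ?_ (ENNReal.rpow_arith_mean_le_arith_mean2_rpow _ _ _ _ hw (p.one_le' t))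
        refine ENNReal.rpow_le_rpow ?_ (exponent_pos p t).le
        rw [Real.enorm_eq_ofReal_abs, Real.enorm_eq_ofReal_abs, Real.enorm_eq_ofReal_abs,
          ← ENNReal.ofReal_mul (by positivity), ← ENNReal.ofReal_mul (by positivity),
          ← ENNReal.ofReal_add (by positivity) (by positivity)]
        refine ENNReal.ofReal_le_ofReal ?_
        rw [abs_div, abs_div, abs_div, abs_of_pos hrs, abs_of_pos hr, abs_of_pos hs]
        have : r / (r + s) * (|f t| / r) + s / (r + s) * (|g t| / s)
            = (|f t| + |g t|) / (r + s) := by field_simp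
        rw [this]
        gcongr
    _ = ENNReal.ofReal (r / (r + s)) * modular p μ (fun t => f t / r)
          + ENNReal.ofReal (s / (r + s)) * modular p μ (fun t => g t / s) := by
        unfold modular
        rw [lintegral_add_left' (hm.const_mul _), lintegral_const_mul'' _ hm,
          lintegral_const_mul' _ _ ENNReal.ofReal_ne_top]
    _ ≤ ENNReal.ofReal (r / (r + s)) * 1 + ENNReal.ofReal (s / (r + s)) * 1 := by gcongr
    _ = 1 := by rw [mul_one, mul_one, hw]

theorem exists_modular_le_one {f : Ω → ℝ} (hf : AEStronglyMeasurable f μ)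
    (h : ∃ r : ℝ, 0 < r ∧ modular p μ (fun t => f t / r) < ∞) :
    ∃ r : ℝ, 0 < r ∧ modular p μ (fun t => f t / r) ≤ 1 := by
  obtain ⟨r, hr, hfin⟩ := h
  set M := (modular p μ (fun t => f t / r)).toReal with hM
  have hM0 : 0 ≤ M := ENNReal.toReal_nonneg
  refine ⟨r * (M + 1), by positivity, ?_⟩
  have key := modular_const_mul_le (p := p) (hf.div₀ aestronglyMeasurable_const) (c := (M + 1)⁻¹)
    (f := fun t => f t / r) (by positivity) (inv_le_one_of_one_le₀ (by linarith))
  have e : (fun t => f t / (r * (M + 1))) = fun t => (M + 1)⁻¹ * (f t / r) := by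
    funext t; field_simp
  rw [e]
  refine key.trans ?_
  rw [← ENNReal.ofReal_toReal hfin.ne, ← hM, ← ENNReal.ofReal_mul (by positivity)]
  refine ENNReal.ofReal_le_one.2 ?_
  rw [inv_mul_le_iff₀ (by positivity)]
  linarith

end Modular

/-- The variable Lebesgue (Nakano) space `L^{p(·)}(μ)`: the classes modulo `μ`-a.e. equality of
real measurable functions `f` such that `ρ_p(f / r) < ∞` for some `r > 0`. -/
def VLp {Ω : Type*} [MeasurableSpace Ω] (p : Exponent Ω) (μ : Measure Ω) :
    Submodule ℝ (Ω →ₘ[μ] ℝ) where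
  carrier := {f | ∃ r : ℝ, 0 < r ∧ modular p μ (fun t => f t / r) < ∞}
  zero_mem' := by
    refine ⟨1, one_pos, ?_⟩
    have : modular p μ (fun t => (0 : Ω →ₘ[μ] ℝ) t / 1) ≤ modular p μ (fun _ => 0) := by
      refine modular_mono ?_
      filter_upwards [AEEqFun.coeFn_zero (α := Ω) (β := ℝ) (μ := μ)] with t ht
      simp [ht]
    refine this.trans_lt ?_
    have h0 : modular p μ (fun _ => (0 : ℝ)) = 0 := by
      unfold modular
      simp [ENNReal.zero_rpow_of_pos (exponent_pos p _)]
    simp [h0]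
  add_mem' := by
    intro f g hf hg
    obtain ⟨r, hr, hfr⟩ := exists_modular_le_one f.aestronglyMeasurable hf
    obtain ⟨s, hs, hgs⟩ := exists_modular_le_one g.aestronglyMeasurable hg
    refine ⟨r + s, add_pos hr hs, lt_of_le_of_lt (modular_add_div_le f.aestronglyMeasurable
      hr hs hfr hgs ?_) ENNReal.one_lt_top⟩
    filter_upwards [AEEqFun.coeFn_add f g] with t ht
    rw [ht]
    exact abs_add_le _ _
  smul_mem' := by
    rintro c f ⟨r, hr, hfr⟩
    refine ⟨r * (|c| + 1), by positivity, lt_of_le_of_lt (modular_mono ?_) hfr⟩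
    filter_upwards [AEEqFun.coeFn_smul c f] with t ht
    rw [ht, Pi.smul_apply, smul_eq_mul, abs_div, abs_mul, abs_div, abs_of_pos hr,
      abs_of_pos (by positivity : 0 < r * (|c| + 1)), div_le_div_iff₀ (by positivity) hr]
    nlinarith [mul_nonneg (abs_nonneg (f t)) hr.le]

variable {Ω : Type*} [MeasurableSpace Ω] {p q : Exponent Ω} {μ : Measure Ω}

theorem exists_le_one (f : VLp p μ) :
    ∃ r : ℝ, 0 < r ∧ modular p μ (fun t => f.1 t / r) ≤ 1 :=
  exists_modular_le_one f.1.aestronglyMeasurable f.2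

/-- The Luxemburg norm `‖f‖ = inf {r > 0 : ρ_p(f / r) ≤ 1}`. -/
instance : Norm (VLp p μ) :=
  ⟨fun f => sInf {r : ℝ | 0 < r ∧ modular p μ (fun t => f.1 t / r) ≤ 1}⟩

theorem norm_def (f : VLp p μ) :
    ‖f‖ = sInf {r : ℝ | 0 < r ∧ modular p μ (fun t => f.1 t / r) ≤ 1} := rfl

theorem norm_le_of_modular {f : VLp p μ} {r : ℝ} (hr : 0 < r)
    (h : modular p μ (fun t => f.1 t / r) ≤ 1) : ‖f‖ ≤ r :=
  csInf_le ⟨0, fun _ hx => hx.1.le⟩ ⟨hr, h⟩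

theorem modular_le_of_norm_lt {f : VLp p μ} {r : ℝ} (h : ‖f‖ < r) :
    0 < r ∧ modular p μ (fun t => f.1 t / r) ≤ 1 := by
  obtain ⟨s, ⟨hs, hs1⟩, hsr⟩ := exists_lt_of_csInf_lt (exists_le_one f) h
  refine ⟨hs.trans hsr, (modular_mono (Eventually.of_forall fun t => ?_)).trans hs1⟩
  rw [abs_div, abs_div, abs_of_pos hs, abs_of_pos (hs.trans hsr)]
  gcongr

theorem norm_nonneg' (f : VLp p μ) : 0 ≤ ‖f‖ := Real.sInf_nonneg fun _ hx => hx.1.le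

theorem norm_smul_le' (c : ℝ) (f : VLp p μ) : ‖c • f‖ ≤ |c| * ‖f‖ := by
  refine le_of_forall_pos_le_add fun ε hε => ?_
  have hc : 0 < |c| + 1 := by positivity
  obtain ⟨h0, h1⟩ := modular_le_of_norm_lt (f := f) (r := ‖f‖ + ε / (2 * (|c| + 1)))
    (by linarith [show 0 < ε / (2 * (|c| + 1)) by positivity])
  set r := ‖f‖ + ε / (2 * (|c| + 1)) with hr
  have hcr : 0 < |c| * r + ε / 2 := by positivity
  refine (norm_le_of_modular (r := |c| * r + ε / 2) hcr ?_).trans ?_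
  · refine (modular_mono ?_).trans h1
    filter_upwards [AEEqFun.coeFn_smul c f.1] with t ht
    have ht' : (c • f).1 t = c * f.1 t := ht
    rw [ht', abs_div, abs_mul, abs_div, abs_of_pos h0, abs_of_pos hcr, div_le_div_iff₀ hcr h0]
    nlinarith [mul_nonneg (abs_nonneg (f.1 t)) hε.le]
  · have : |c| * (ε / (2 * (|c| + 1))) ≤ ε / 2 := by
      rw [← mul_div_assoc, div_le_div_iff₀ (by positivity) two_pos]
      nlinarith [abs_nonneg c]
    rw [hr, mul_add]
    linarith

theorem norm_add_le' (f g : VLp p μ) : ‖f + g‖ ≤ ‖f‖ + ‖g‖ := by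
  refine le_of_forall_pos_le_add fun ε hε => ?_
  obtain ⟨hr, hr1⟩ := modular_le_of_norm_lt (f := f) (r := ‖f‖ + ε / 2) (by linarith)
  obtain ⟨hs, hs1⟩ := modular_le_of_norm_lt (f := g) (r := ‖g‖ + ε / 2) (by linarith)
  refine (norm_le_of_modular (add_pos hr hs) (modular_add_div_le (f := f.1) (g := g.1)
    f.1.aestronglyMeasurable hr hs hr1 hs1 ?_)).trans (by linarith)
  filter_upwards [AEEqFun.coeFn_add f.1 g.1] with t ht
  have ht' : (f + g).1 t = f.1 t + g.1 t := ht
  rw [ht']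
  exact abs_add_le _ _

theorem eq_zero_of_norm {f : VLp p μ} (hf : ‖f‖ = 0) : f = 0 := by
  have key : modular p μ f.1 ≤ 0 := by
    refine le_of_forall_pos_le_add fun ε hε => ?_
    obtain ⟨δ, hδ0, hδε⟩ : ∃ δ : ℝ, 0 < δ ∧ ENNReal.ofReal δ ≤ ε := by
      rcases eq_or_ne ε ∞ with rfl | hε'
      · exact ⟨1, one_pos, le_top⟩
      · exact ⟨ε.toReal, ENNReal.toReal_pos hε.ne' hε', (ENNReal.ofReal_toReal hε').le⟩
    set r := min δ 1
    have hr0 : 0 < r := lt_min hδ0 one_pos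
    obtain ⟨_, h1⟩ := modular_le_of_norm_lt (f := f) (r := r) (by rw [hf]; exact hr0)
    have h2 := modular_const_mul_le (p := p) (f := fun t => f.1 t / r)
      (f.1.aestronglyMeasurable.div₀ aestronglyMeasurable_const) hr0.le (min_le_right δ 1)
    have e : (fun t => r * (f.1 t / r)) = f.1 := by
      funext t; field_simp
    rw [e] at h2
    calc modular p μ f.1 ≤ ENNReal.ofReal r * 1 := h2.trans (by gcongr)
      _ ≤ ENNReal.ofReal δ := by
          rw [mul_one]; exact ENNReal.ofReal_le_ofReal (min_le_left _ _)
      _ ≤ 0 + ε := by rw [zero_add]; exact hδε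
  have h0 : modular p μ f.1 = 0 := le_antisymm key zero_le
  unfold modular at h0
  rw [lintegral_eq_zero_iff' (f.1.aestronglyMeasurable.enorm.pow p.measurable'.aemeasurable)] at h0
  refine Subtype.ext (AEEqFun.ext ?_)
  filter_upwards [h0, AEEqFun.coeFn_zero (α := Ω) (β := ℝ) (μ := μ)] with t ht hz
  have hz' : (0 : VLp p μ).1 t = 0 := hz
  rw [hz']
  simpa [ENNReal.rpow_eq_zero_iff, exponent_pos p t, (exponent_pos p t).not_gt] using ht

theorem normCore : NormedSpace.Core ℝ (VLp p μ) where
  norm_nonneg := norm_nonneg'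
  norm_smul c f := by
    refine le_antisymm (norm_smul_le' c f) ?_
    rcases eq_or_ne c 0 with rfl | hc
    · simpa using norm_nonneg' _
    · have h := norm_smul_le' c⁻¹ (c • f)
      rw [inv_smul_smul₀ hc, abs_inv, ← div_eq_inv_mul, le_div_iff₀ (abs_pos.2 hc)] at h
      rw [Real.norm_eq_abs, mul_comm]
      exact h
  norm_triangle := norm_add_le'
  norm_eq_zero_iff f := by
    refine ⟨eq_zero_of_norm, ?_⟩
    rintro rfl
    have h := norm_smul_le' (0 : ℝ) (0 : VLp p μ)
    rw [zero_smul, abs_zero, zero_mul] at h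
    exact le_antisymm h (norm_nonneg' _)

instance : NormedAddCommGroup (VLp p μ) := NormedAddCommGroup.ofCore normCore

instance : NormedSpace ℝ (VLp p μ) := NormedSpace.ofCore normCore

theorem mem_of_abs_le_add {f g h : Ω →ₘ[μ] ℝ} (hf : f ∈ VLp p μ) (hg : g ∈ VLp p μ)
    (hh : ∀ᵐ t ∂μ, |h t| ≤ |f t| + |g t|) : h ∈ VLp p μ := by
  obtain ⟨r, hr, hfr⟩ := exists_le_one ⟨f, hf⟩
  obtain ⟨s, hs, hgs⟩ := exists_le_one ⟨g, hg⟩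
  exact ⟨r + s, add_pos hr hs, lt_of_le_of_lt (modular_add_div_le f.aestronglyMeasurable
      hr hs hfr hgs hh) ENNReal.one_lt_top⟩

/-- The lattice structure of `L^{p(·)}(μ)`, with the `μ`-a.e. pointwise order. -/
instance : Lattice (VLp p μ) :=
  Subtype.lattice
    (fun f g hf hg => mem_of_abs_le_add hf hg (by
      filter_upwards [AEEqFun.coeFn_sup f g] with t ht
      rw [ht]
      rcases max_cases (f t) (g t) with h | h <;> rw [h.1] <;> simp))
    (fun f g hf hg => mem_of_abs_le_add hf hg (by
      filter_upwards [AEEqFun.coeFn_inf f g] with t ht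
      rw [ht]
      rcases min_cases (f t) (g t) with h | h <;> rw [h.1] <;> simp))

theorem modular_le_add (hqp : ∀ᵐ t ∂μ, q t ≤ p t) (f : Ω → ℝ) :
    modular q μ f ≤ μ univ + modular p μ f := by
  calc modular q μ f ≤ ∫⁻ t, (1 + ‖f t‖ₑ ^ p t) ∂μ := by
        refine lintegral_mono_ae (hqp.mono fun t ht => ?_)
        rcases le_total ‖f t‖ₑ 1 with h | h
        · exact (ENNReal.rpow_le_one h (exponent_pos q t).le).trans le_self_add
        · exact (ENNReal.rpow_le_rpow_of_exponent_le h ht).trans le_add_self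
    _ = μ univ + modular p μ f := by
        rw [lintegral_add_left measurable_const, lintegral_one]
        rfl

theorem mem_of_le [IsFiniteMeasure μ] (hqp : ∀ᵐ t ∂μ, q t ≤ p t) {f : Ω →ₘ[μ] ℝ}
    (hf : f ∈ VLp p μ) : f ∈ VLp q μ := by
  obtain ⟨r, hr, hfr⟩ := hf
  exact ⟨r, hr, (modular_le_add hqp _).trans_lt
    (ENNReal.add_lt_top.2 ⟨measure_lt_top μ univ, hfr⟩)⟩

theorem norm_incl_le [IsFiniteMeasure μ] (hqp : ∀ᵐ t ∂μ, q t ≤ p t) (f : VLp p μ) :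
    ‖(⟨f.1, mem_of_le hqp f.2⟩ : VLp q μ)‖ ≤ (μ.real univ + 1) * ‖f‖ := by
  have hM : 0 ≤ μ.real univ := measureReal_nonneg
  refine le_of_forall_pos_le_add fun ε hε => ?_
  obtain ⟨h0, h1⟩ := modular_le_of_norm_lt (f := f) (r := ‖f‖ + ε / (μ.real univ + 1))
    (by linarith [show 0 < ε / (μ.real univ + 1) by positivity])
  set r := ‖f‖ + ε / (μ.real univ + 1) with hr
  have hb : (μ.real univ + 1) * r = (μ.real univ + 1) * ‖f‖ + ε := by
    rw [hr]; field_simp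
  rw [← hb]
  refine norm_le_of_modular (by positivity) ?_
  have e : (fun t => f.1 t / ((μ.real univ + 1) * r))
      = fun t => (μ.real univ + 1)⁻¹ * (f.1 t / r) := by
    funext t; field_simp
  change modular q μ (fun t => f.1 t / ((μ.real univ + 1) * r)) ≤ 1
  rw [e]
  refine (modular_const_mul_le (f.1.aestronglyMeasurable.div₀ aestronglyMeasurable_const)
    (by positivity) (inv_le_one_of_one_le₀ (by linarith))).trans ?_
  calc ENNReal.ofReal (μ.real univ + 1)⁻¹ * modular q μ (fun t => f.1 t / r)
      ≤ ENNReal.ofReal (μ.real univ + 1)⁻¹ * (μ univ + 1) := by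
        gcongr
        exact (modular_le_add hqp _).trans (by gcongr)
    _ = ENNReal.ofReal (μ.real univ + 1)⁻¹ * ENNReal.ofReal (μ.real univ + 1) := by
        rw [ENNReal.ofReal_add hM zero_le_one, ENNReal.ofReal_one, ofReal_measureReal]
    _ = 1 := by
        rw [← ENNReal.ofReal_mul (by positivity), inv_mul_cancel₀ (by positivity),
          ENNReal.ofReal_one]

/-- The inclusion `L^{p(·)}(μ) ↪ L^{q(·)}(μ)`, `f ↦ f`, as a bounded operator, for a finite
measure `μ` and exponents with `q ≤ p` almost everywhere. -/
def inclusion [IsFiniteMeasure μ] (hqp : ∀ᵐ t ∂μ, q t ≤ p t) : VLp p μ →L[ℝ] VLp q μ :=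
  LinearMap.mkContinuous
    { toFun := fun f => ⟨f.1, mem_of_le hqp f.2⟩
      map_add' := fun _ _ => rfl
      map_smul' := fun _ _ => rfl }
    (μ.real univ + 1) (norm_incl_le hqp)

end VarLebesgue

/-- The restriction of the operator `T` to the subspace `M` is an isomorphism (a linear
homeomorphism) onto its image. -/
def IsIsomorphismOn {E F : Type*} [NormedAddCommGroup E] [NormedSpace ℝ E]
    [NormedAddCommGroup F] [NormedSpace ℝ F] (T : E →L[ℝ] F) (M : Submodule ℝ E) : Prop :=
  ∃ e : M ≃L[ℝ] Submodule.map (T : E →ₗ[ℝ] F) M, ∀ x : M, (e x : F) = T x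

/-- An operator `T` from a normed lattice `E` is disjointly strictly singular if its restriction
to the closed linear span of a normalized pairwise disjoint sequence is never an isomorphism. -/
def DisjointlyStrictlySingular {E F : Type*} [NormedAddCommGroup E] [NormedSpace ℝ E] [Lattice E]
    [NormedAddCommGroup F] [NormedSpace ℝ F] (T : E →L[ℝ] F) : Prop :=
  ∀ f : ℕ → E, (∀ n, ‖f n‖ = 1) → (∀ m n, m ≠ n → |f m| ⊓ |f n| = 0) →
    ¬ IsIsomorphismOn T (Submodule.span ℝ (range f)).topologicalClosure

/-- The decreasing rearrangement `f^*(x) = inf {s ≥ 0 : μ {t : |f t| > s} ≤ x}`. -/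
def decreasingRearrangement {Ω : Type*} [MeasurableSpace Ω] (μ : Measure Ω) (f : Ω → ℝ)
    (x : ℝ) : ℝ :=
  sInf {s : ℝ | 0 ≤ s ∧ μ {t | s < |f t|} ≤ ENNReal.ofReal x}

/-- `|f x - f y| ≤ C / ln (e + 1 / d(x, y))` for all `x ≠ y` and some constant `C > 0`. -/
def LogHolderContinuous {X : Type*} [MetricSpace X] (f : X → ℝ) : Prop :=
  ∃ C : ℝ, 0 < C ∧ ∀ x y : X, x ≠ y →
    |f x - f y| ≤ C / Real.log (Real.exp 1 + 1 / dist x y)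

end

/-! With `d = p - q`, no implication between the three conditions is proved directly. The function
`d` is continuous and nonnegative on a compact space, so it either has a zero or is bounded below by
some `a > 0` (`exists_eq_zero_or_gap`). In the second case all three conditions hold; in the first
all three fail.

If `d ≥ a`, then `(1 - x) ^ d^*(x) ≤ (1 - x) ^ a`. Normalized disjoint functions have supports of
measure tending to `0`, and `|f|^q ≤ M^(-a) |f|^p` above height `M`, so their norms in `L^q` tend to
`0` (`modular_le_of_gap`).

If `d t₀ = 0`, log-Hölder continuity gives `d ≤ C / ln (1/h)` within distance `h` of `t₀`, that is,
`h ^ d ≥ exp (-C)`. This keeps the limit in the third condition away from `0`. On dyadic shells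
around `t₀` the normalized indicators have height `c = O(1/h)`, so `c ^ (p - q)` is bounded and the
two modulars are comparable. The inclusion is then an isomorphism on their closed span
(`norm_le_norm_inclusion_of_eq_on`). -/

/-! ### Log-Hölder continuity in logarithmic form -/

namespace LogHolderContinuous

variable {X : Type*} [MetricSpace X] {f g : X → ℝ}

theorem one_le_log (x y : X) : 1 ≤ Real.log (Real.exp 1 + 1 / dist x y) := by
  rw [Real.le_log_iff_exp_le (by positivity)]
  have : 0 ≤ 1 / dist x y := by positivity
  linarith

theorem sub (hf : LogHolderContinuous f) (hg : LogHolderContinuous g) :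
    LogHolderContinuous fun x => f x - g x := by
  obtain ⟨C, hC, hf⟩ := hf
  obtain ⟨D, hD, hg⟩ := hg
  refine ⟨C + D, by positivity, fun x y hxy => ?_⟩
  rw [add_div]
  calc |f x - g x - (f y - g y)| = |(f x - f y) - (g x - g y)| := by ring_nf
    _ ≤ |f x - f y| + |g x - g y| := abs_sub _ _
    _ ≤ _ := add_le_add (hf x y hxy) (hg x y hxy)

/-- A log-Hölder continuous function satisfies `|f x - f y| ln (1 / h) ≤ C` for `d(x, y) ≤ h`. -/
theorem exists_abs_sub_mul_log_le (hf : LogHolderContinuous f) :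
    ∃ C : ℝ, 0 < C ∧ ∀ x y : X, ∀ h : ℝ, 0 < h → dist x y ≤ h →
      |f x - f y| * Real.log (1 / h) ≤ C := by
  obtain ⟨C, hC, hf⟩ := hf
  refine ⟨C, hC, fun x y h h0 hd => ?_⟩
  rcases eq_or_ne x y with rfl | hxy
  · simpa using hC.le
  have hd0 : 0 < dist x y := dist_pos.2 hxy
  have hl := one_le_log x y
  have h1 := hf x y hxy
  rw [le_div_iff₀ (by linarith)] at h1
  refine le_trans ?_ h1
  gcongr
  have : 0 < Real.exp 1 := Real.exp_pos 1
  have : 1 / h ≤ 1 / dist x y := one_div_le_one_div_of_le hd0 hd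
  linarith

theorem continuous (hf : LogHolderContinuous f) : Continuous f := by
  obtain ⟨C, hC, hf⟩ := hf.exists_abs_sub_mul_log_le
  -- The radius is chosen so that `ln (1/δ) = 2C/ε`; an oscillation of at least `ε` would then force
  -- `2C ≤ C`.
  refine Metric.continuous_iff.2 fun y ε hε => ⟨Real.exp (-(2 * C / ε)), Real.exp_pos _,
    fun x hx => ?_⟩
  have h1 := hf x y _ (Real.exp_pos _) hx.le
  rw [one_div, ← Real.exp_neg, neg_neg, Real.log_exp] at h1
  rw [Real.dist_eq]
  by_contra! h2
  have h3 : ε * (2 * C / ε) ≤ C := le_trans (by gcongr) h1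
  rw [mul_div_cancel₀ _ hε.ne'] at h3
  linarith

end LogHolderContinuous

/-! ### Measure of shells in the unit interval -/

namespace unitInterval

/-- Since `b ≤ 1/2`, the half of the shell on the side of `t₀` away from the nearer endpoint lies
inside `[0,1]`, and that half is an interval of length `b - a`. -/
theorem ofReal_sub_le_volume_shell (t₀ : unitInterval) {a b : ℝ} (ha : 0 ≤ a) (hab : a ≤ b)
    (hb : b ≤ 1 / 2) :
    ENNReal.ofReal (b - a) ≤ volume {t : unitInterval | a < dist t t₀ ∧ dist t t₀ ≤ b} := by
  have h0 := t₀.2.1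
  have h1 := t₀.2.2
  rcases le_total (t₀ : ℝ) (1 / 2) with h | h
  · have hv := volume_Ioc ⟨(t₀ : ℝ) + a, by constructor <;> linarith⟩
      ⟨(t₀ : ℝ) + b, by constructor <;> linarith⟩
    rw [show (t₀ : ℝ) + b - (t₀ + a) = b - a by ring] at hv
    rw [← hv]
    refine measure_mono fun t ht => ?_
    have ht1 : (t₀ : ℝ) + a < t := ht.1
    have ht2 : (t : ℝ) ≤ t₀ + b := ht.2
    rw [mem_ofPred_eq, Subtype.dist_eq, Real.dist_eq, abs_of_nonneg (by linarith)]
    constructor <;> linarith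
  · have hv := volume_Ico ⟨(t₀ : ℝ) - b, by constructor <;> linarith⟩
      ⟨(t₀ : ℝ) - a, by constructor <;> linarith⟩
    rw [show (t₀ : ℝ) - a - (t₀ - b) = b - a by ring] at hv
    rw [← hv]
    refine measure_mono fun t ht => ?_
    have ht1 : (t₀ : ℝ) - b ≤ t := ht.1
    have ht2 : (t : ℝ) < t₀ - a := ht.2
    rw [mem_ofPred_eq, Subtype.dist_eq, Real.dist_eq, abs_of_nonpos (by linarith)]
    constructor <;> linarith

instance : (volume : Measure unitInterval).IsOpenPosMeasure where
  open_pos U hU := by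
    rintro ⟨t, ht⟩ h0
    obtain ⟨ε, hε, hball⟩ := Metric.isOpen_iff.1 hU t ht
    set h := min (ε / 2) (1 / 2) with hh
    have hpos : 0 < h := lt_min (half_pos hε) (by norm_num)
    have hsub : {s : unitInterval | 0 < dist s t ∧ dist s t ≤ h} ⊆ U := fun s hs =>
      hball (Metric.mem_ball.2 (hs.2.trans_lt ((min_le_left _ _).trans_lt (half_lt_self hε))))
    have h1 := (ofReal_sub_le_volume_shell t le_rfl hpos.le (min_le_right _ _)).trans
      (measure_mono hsub)
    rw [h0, sub_zero, nonpos_iff_eq_zero, ENNReal.ofReal_eq_zero] at h1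
    exact absurd hpos h1.not_gt

end unitInterval

/-! ### The decreasing rearrangement near 1 -/

section Rearrangement

variable {Ω : Type*} [MeasurableSpace Ω] {μ : Measure Ω} {f : Ω → ℝ}

theorem decreasingRearrangement_le {x s : ℝ} (hs : 0 ≤ s)
    (h : μ {t | s < |f t|} ≤ ENNReal.ofReal x) : decreasingRearrangement μ f x ≤ s :=
  csInf_le ⟨0, fun _ hx => hx.1⟩ ⟨hs, h⟩

theorem le_decreasingRearrangement [IsProbabilityMeasure μ] {a B x : ℝ} (hx : x < 1)
    (hB : ∀ t, |f t| ≤ B) (ha : ∀ᵐ t ∂μ, a ≤ |f t|) : a ≤ decreasingRearrangement μ f x := by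
  -- The infimum of an empty set of reals is `0`, so the bound `B` is needed to exhibit a member.
  refine le_csInf ⟨max B 0, le_max_right _ _, ?_⟩ fun s hs => ?_
  · have : {t | max B 0 < |f t|} = ∅ :=
      eq_empty_of_forall_notMem fun t ht => absurd ((le_max_left B 0).trans_lt ht) (hB t).not_gt
    rw [this, measure_empty]
    exact zero_le
  · by_contra! hsa
    have h1 : μ {t | s < |f t|} = 1 := by
      rw [← measure_univ (μ := μ)]
      exact measure_congr (eventuallyEq_univ.2 (ha.mono fun t ht => hsa.trans_le ht))
    have h2 := hs.2
    rw [h1] at h2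
    exact absurd (ENNReal.one_le_ofReal.1 h2) hx.not_ge

theorem tendsto_one_sub_rpow_of_gap [IsProbabilityMeasure μ] {a B : ℝ} (ha0 : 0 < a)
    (hB : ∀ t, |f t| ≤ B) (ha : ∀ᵐ t ∂μ, a ≤ |f t|) :
    Tendsto (fun x : ℝ => (1 - x) ^ decreasingRearrangement μ f x) (𝓝[<] 1) (𝓝 0) := by
  have hlim : Tendsto (fun x : ℝ => (1 - x) ^ a) (𝓝[<] 1) (𝓝 0) := by
    have hc : Continuous fun x : ℝ => (1 - x) ^ a :=
      (continuous_const.sub continuous_id).rpow_const fun _ => Or.inr ha0.le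
    have := hc.tendsto 1
    rw [sub_self, Real.zero_rpow ha0.ne'] at this
    exact this.mono_left nhdsWithin_le_nhds
  have hmem : Ioo (0 : ℝ) 1 ∈ 𝓝[<] (1 : ℝ) := Ioo_mem_nhdsLT zero_lt_one
  refine tendsto_of_tendsto_of_tendsto_of_le_of_le' tendsto_const_nhds hlim ?_ ?_
  · filter_upwards [hmem] with x hx
    exact Real.rpow_nonneg (by linarith [hx.2]) _
  · filter_upwards [hmem] with x hx
    exact Real.rpow_le_rpow_of_exponent_ge (by linarith [hx.2]) (by linarith [hx.1])
      (le_decreasingRearrangement hx.2 hB ha)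

end Rearrangement

/-- Put `x = 1 - h`. The set where `|d| > C / ln (1/h)` misses a shell of measure at least `h`
around `t₀`, so `d^*(x) ≤ C / ln (1/h)`. Hence `(1 - x) ^ d^*(x) ≥ h ^ (C / ln (1/h)) = exp (-C)`.
-/
theorem not_tendsto_one_sub_rpow_of_zero {d : unitInterval → ℝ} (hd : LogHolderContinuous d)
    {t₀ : unitInterval} (h0 : d t₀ = 0) :
    ¬ Tendsto (fun x : ℝ => (1 - x) ^ decreasingRearrangement volume d x) (𝓝[<] 1) (𝓝 0) := by
  obtain ⟨C, hC, hd'⟩ := hd.exists_abs_sub_mul_log_le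
  intro hlim
  have hmem : Ioo (1 / 2 : ℝ) 1 ∈ 𝓝[<] (1 : ℝ) := Ioo_mem_nhdsLT (by norm_num)
  obtain ⟨x, hlt, hx⟩ := ((hlim.eventually_lt_const (Real.exp_pos (-C))).and hmem).exists
  refine hlt.not_ge ?_
  set h := 1 - x with hh
  have hpos : 0 < h := by linarith [hx.2]
  have hhalf : h ≤ 1 / 2 := by linarith [hx.1]
  have hlog : 0 < Real.log (1 / h) := Real.log_pos (by rw [lt_div_iff₀ hpos]; linarith)
  have hle : decreasingRearrangement volume d x ≤ C / Real.log (1 / h) := by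
    refine decreasingRearrangement_le (by positivity) ?_
    have hsub : {t | C / Real.log (1 / h) < |d t|} ⊆
        {t : unitInterval | 0 < dist t t₀ ∧ dist t t₀ ≤ h}ᶜ := by
      intro t ht ht'
      have h1 := hd' t t₀ h hpos ht'.2
      rw [h0, sub_zero, ← le_div_iff₀ hlog] at h1
      exact absurd h1 (not_le.2 ht)
    have hms : MeasurableSet {t : unitInterval | 0 < dist t t₀ ∧ dist t t₀ ≤ h} :=
      (measurableSet_lt measurable_const (measurable_id.dist measurable_const)).inter
        (measurableSet_le (measurable_id.dist measurable_const) measurable_const)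
    refine (measure_mono hsub).trans ?_
    rw [prob_compl_eq_one_sub hms]
    have hv := unitInterval.ofReal_sub_le_volume_shell t₀ le_rfl hpos.le hhalf
    rw [sub_zero] at hv
    refine (tsub_le_tsub_left hv 1).trans ?_
    rw [← ENNReal.ofReal_one, ← ENNReal.ofReal_sub _ hpos.le]
    exact ENNReal.ofReal_le_ofReal (by linarith)
  calc Real.exp (-C) = h ^ (C / Real.log (1 / h)) := by
        rw [Real.rpow_def_of_pos hpos, one_div, Real.log_inv]
        have : Real.log h ≠ 0 := by
          rw [one_div, Real.log_inv] at hlog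
          linarith
        congr 1
        field_simp
    _ ≤ _ := Real.rpow_le_rpow_of_exponent_ge hpos (by linarith) hle

/-! ### The dichotomy: a zero or a uniform gap -/

/-- The set where the inequality holds is closed, and dense because its complement is null. -/
theorem forall_le_of_ae_le {X : Type*} [TopologicalSpace X] [MeasurableSpace X] {μ : Measure X}
    [μ.IsOpenPosMeasure] {f g : X → ℝ} (hf : Continuous f) (hg : Continuous g)
    (h : ∀ᵐ t ∂μ, f t ≤ g t) (t : X) : f t ≤ g t := by
  have := (Measure.dense_of_ae h).closure_eq
  rw [(isClosed_le hf hg).closure_eq] at this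
  exact this.ge (mem_univ t)

theorem exists_eq_zero_or_gap {X : Type*} [TopologicalSpace X] [CompactSpace X] [Nonempty X]
    [MeasurableSpace X] {μ : Measure X} [μ.IsOpenPosMeasure] {d : X → ℝ} (hd : Continuous d)
    (h0 : ∀ᵐ t ∂μ, 0 ≤ d t) : (∃ t, d t = 0) ∨ ∃ a, 0 < a ∧ ∀ t, a ≤ d t := by
  obtain ⟨t₀, -, ht₀⟩ := isCompact_univ.exists_isMinOn univ_nonempty hd.continuousOn
  have hall := forall_le_of_ae_le continuous_const hd h0
  rcases (hall t₀).eq_or_lt with h | h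
  · exact Or.inl ⟨t₀, h.symm⟩
  · exact Or.inr ⟨d t₀, h, fun t => ht₀ (mem_univ t)⟩

/-- The reals are only conditionally complete, so boundedness of `d` is what makes `essInf`
meaningful here. -/
theorem essInf_pos_iff {Ω : Type*} [MeasurableSpace Ω] {μ : Measure Ω} [NeZero μ] {d : Ω → ℝ}
    {B : ℝ} (hB : ∀ t, |d t| ≤ B) :
    0 < essInf d μ ↔ ∃ a, 0 < a ∧ ∀ᵐ t ∂μ, a ≤ d t := by
  have hbdd : IsBoundedUnder (· ≥ ·) (ae μ) d :=
    ⟨-B, eventually_map.2 (Eventually.of_forall fun t => neg_le_of_abs_le (hB t))⟩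
  have hcob : IsCoboundedUnder (· ≥ ·) (ae μ) d :=
    IsBoundedUnder.isCoboundedUnder_ge
      ⟨B, eventually_map.2 (Eventually.of_forall fun t => le_of_abs_le (hB t))⟩
  constructor
  · intro h
    exact ⟨essInf d μ / 2, half_pos h,
      (eventually_lt_of_lt_liminf (half_lt_self h) hbdd).mono fun _ ht => ht.le⟩
  · rintro ⟨a, ha, h⟩
    exact ha.trans_le (le_liminf_of_le hcob h)

/-! ### Isomorphisms onto the image and lower norm bounds -/

section Isomorphism

variable {E F : Type*} [NormedAddCommGroup E] [NormedSpace ℝ E]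
  [NormedAddCommGroup F] [NormedSpace ℝ F] {T : E →L[ℝ] F} {M : Submodule ℝ E}

theorem IsIsomorphismOn.exists_norm_le (h : IsIsomorphismOn T M) :
    ∃ K : ℝ, 0 < K ∧ ∀ x ∈ M, ‖x‖ ≤ K * ‖T x‖ := by
  obtain ⟨e, he⟩ := h
  obtain ⟨K, hK, hle⟩ := (e.symm : Submodule.map (T : E →ₗ[ℝ] F) M →L[ℝ] M).bound
  refine ⟨K, hK, fun x hx => ?_⟩
  have := hle (e ⟨x, hx⟩)
  rw [ContinuousLinearEquiv.coe_coe, e.symm_apply_apply] at this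
  rw [← he ⟨x, hx⟩]
  exact this

theorem isIsomorphismOn_of_norm_le (hT : Function.Injective T) {K : ℝ}
    (h : ∀ x ∈ M, ‖x‖ ≤ K * ‖T x‖) : IsIsomorphismOn T M := by
  let e := Submodule.equivMapOfInjective (T : E →ₗ[ℝ] F) hT M
  have he : ∀ x : M, (e x : F) = T x := fun x => rfl
  refine ⟨e.toContinuousLinearEquivOfBounds ‖T‖ K (fun x => T.le_opNorm x) fun y => ?_, he⟩
  have h1 := h (e.symm y) (e.symm y).2
  rw [← he, e.apply_symm_apply] at h1
  exact h1

/-- The lower bound is a closed condition on `x`, so it is enough to check it on finite linear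
combinations. -/
theorem isIsomorphismOn_closure_of_norm_le (hT : Function.Injective T) {K : ℝ}
    (h : ∀ x ∈ M, ‖x‖ ≤ K * ‖T x‖) : IsIsomorphismOn T M.topologicalClosure := by
  refine isIsomorphismOn_of_norm_le hT (K := K) fun x hx => ?_
  have hcl : IsClosed {x : E | ‖x‖ ≤ K * ‖T x‖} :=
    isClosed_le continuous_norm (continuous_const.mul T.continuous.norm)
  exact closure_minimal (s := (M : Set E)) h hcl hx

end Isomorphism

/-! ### A uniform gap forces strict singularity -/

namespace VarLebesgue

variable {Ω : Type*} [MeasurableSpace Ω] {p q : Exponent Ω} {μ : Measure Ω}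

theorem enorm_rpow_eq_ofReal (x : ℝ) {y : ℝ} (hy : 0 ≤ y) :
    ‖x‖ₑ ^ y = ENNReal.ofReal (|x| ^ y) := by
  rw [Real.enorm_eq_ofReal_abs, ENNReal.ofReal_rpow_of_nonneg (abs_nonneg x) hy]

theorem coeFn_abs (f : VLp p μ) : ∀ᵐ t ∂μ, |f|.1 t = |f.1 t| :=
  AEEqFun.coeFn_abs f.1

theorem abs_inf_abs_eq_zero_iff {f g : VLp p μ} :
    |f| ⊓ |g| = 0 ↔ ∀ᵐ t ∂μ, f.1 t = 0 ∨ g.1 t = 0 := by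
  have hinf : ∀ᵐ t ∂μ, (|f| ⊓ |g|).1 t = min |f.1 t| |g.1 t| := by
    filter_upwards [AEEqFun.coeFn_inf |f|.1 |g|.1, coeFn_abs f, coeFn_abs g] with t h1 h2 h3
    have h1' : (|f| ⊓ |g|).1 t = |f|.1 t ⊓ |g|.1 t := h1
    rw [h1', h2, h3]
  have hz : ∀ᵐ t ∂μ, (0 : VLp p μ).1 t = 0 := AEEqFun.coeFn_zero
  have key : ∀ x y : ℝ, min |x| |y| = 0 ↔ x = 0 ∨ y = 0 := fun x y => by
    rcases min_choice |x| |y| with h | h <;>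
      grind [abs_nonneg x, abs_nonneg y, abs_eq_zero (a := x), abs_eq_zero (a := y)]
  constructor
  · intro h
    filter_upwards [hinf, hz] with t h1 h2
    rw [h, h2] at h1
    exact (key _ _).1 h1.symm
  · intro h
    refine Subtype.ext (AEEqFun.ext ?_)
    filter_upwards [hinf, hz, h] with t h1 h2 h3
    rw [h1, h2, (key _ _).2 h3]

theorem modular_const_mul_le_rpow {P : ℝ} (hP : ∀ t, p t ≤ P) {c : ℝ} (hc : 1 ≤ c) (f : Ω → ℝ) :
    modular p μ (fun t => c * f t) ≤ ENNReal.ofReal (c ^ P) * modular p μ f := by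
  unfold modular
  rw [← lintegral_const_mul' _ _ ENNReal.ofReal_ne_top]
  refine lintegral_mono fun t => ?_
  rw [enorm_mul, ENNReal.mul_rpow_of_nonneg _ _ (exponent_pos p t).le,
    enorm_rpow_eq_ofReal c (exponent_pos p t).le, abs_of_pos (by linarith)]
  gcongr
  exact hP t

/-- Split at height `M`: where `|f| ≥ M`, a factor `|f|^(p - q) ≥ M^a` is gained; elsewhere on the
support `|f|^q ≤ M^P`. -/
theorem modular_le_of_gap {P a M : ℝ} (ha : 0 ≤ a) (hP : ∀ t, q t ≤ P) (hgap : ∀ᵐ t ∂μ, q t + a ≤ p t)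
    (hM : 1 ≤ M) {f : Ω → ℝ} (hf : Measurable f) :
    modular q μ f ≤ ENNReal.ofReal (M ^ (-a)) * modular p μ f
      + ENNReal.ofReal (M ^ P) * μ {t | f t ≠ 0} := by
  have hms : MeasurableSet {t | f t ≠ 0} := (measurableSet_eq_fun hf measurable_const).compl
  rw [← lintegral_indicator_const hms, modular, modular,
    ← lintegral_const_mul' _ _ ENNReal.ofReal_ne_top,
    ← lintegral_add_right _ (measurable_const.indicator hms)]
  refine lintegral_mono_ae (hgap.mono fun t ht => ?_)
  have hM0 : 0 < M := by linarith
  by_cases h0 : f t = 0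
  · rw [h0, enorm_zero, ENNReal.zero_rpow_of_pos (exponent_pos q t)]
    exact zero_le
  rw [indicator_of_mem (by exact h0), enorm_rpow_eq_ofReal _ (exponent_pos q t).le,
    enorm_rpow_eq_ofReal _ (exponent_pos p t).le]
  rcases le_total |f t| M with h | h
  · refine le_add_left (ENNReal.ofReal_le_ofReal ?_)
    calc |f t| ^ q t ≤ M ^ q t := Real.rpow_le_rpow (abs_nonneg _) h (exponent_pos q t).le
      _ ≤ M ^ P := Real.rpow_le_rpow_of_exponent_le hM (hP t)
  · refine le_add_right ?_
    rw [← ENNReal.ofReal_mul (by positivity)]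
    refine ENNReal.ofReal_le_ofReal ?_
    have hfp : 0 < |f t| := hM0.trans_le h
    calc |f t| ^ q t = M ^ (-a) * (|f t| ^ q t * M ^ a) := by
          rw [mul_left_comm, ← Real.rpow_add hM0, neg_add_cancel, Real.rpow_zero, mul_one]
      _ ≤ M ^ (-a) * (|f t| ^ q t * |f t| ^ (p t - q t)) := by
          gcongr
          exact (Real.rpow_le_rpow_of_exponent_le hM (by linarith)).trans
            (Real.rpow_le_rpow hM0.le h (by linarith))
      _ = M ^ (-a) * |f t| ^ p t := by rw [← Real.rpow_add hfp, add_sub_cancel]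

/-- If `q + a ≤ p ≤ P` with `a > 0`, the inclusion sends disjoint normalized sequences to
sequences with arbitrarily small norms. -/
theorem disjointlyStrictlySingular_inclusion_of_gap [IsFiniteMeasure μ]
    (hqp : ∀ᵐ t ∂μ, q t ≤ p t) {P a : ℝ} (ha : 0 < a) (hP : ∀ t, q t ≤ P)
    (hgap : ∀ᵐ t ∂μ, q t + a ≤ p t) : DisjointlyStrictlySingular (inclusion hqp) := by
  intro f hf1 hdisj hiso
  obtain ⟨K, hK, hle⟩ := hiso.exists_norm_le
  have hlow : ∀ n, 1 ≤ K * ‖inclusion hqp (f n)‖ := fun n => by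
    rw [← hf1 n]
    exact hle _ (Submodule.le_topologicalClosure _ (Submodule.subset_span (mem_range_self n)))
  let A : ℕ → Set Ω := fun n => {t | (f n).1 t ≠ 0}
  have hAm : ∀ n, MeasurableSet (A n) := fun n =>
    (measurableSet_eq_fun (AEEqFun.measurable _) measurable_const).compl
  -- The supports are almost everywhere disjoint in a finite measure space, so their measures are
  -- summable.
  have hA0 : Tendsto (fun n => μ (A n)) atTop (𝓝 0) := by
    refine ENNReal.tendsto_atTop_zero_of_tsum_ne_top ?_
    rw [← measure_iUnion₀ (fun m n hmn => ?_) fun n => (hAm n).nullMeasurableSet]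
    · exact measure_ne_top μ _
    · refine measure_mono_null (t := {t | ¬ ((f m).1 t = 0 ∨ (f n).1 t = 0)}) ?_
        (ae_iff.1 (abs_inf_abs_eq_zero_iff.1 (hdisj m n hmn)))
      rintro t ⟨h1, h2⟩
      exact not_or.2 ⟨h1, h2⟩
  -- The norm of `f n` in `L^q` will be at most `2 / c`, which contradicts `hlow` as soon as `c >
  -- 2K`; `c ≥ 1` is needed for scaling.
  set c : ℝ := 4 * K + 1 with hc
  have hc1 : 1 ≤ c := by linarith
  have hcP : 0 < c ^ P := Real.rpow_pos_of_pos (by linarith) P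
  -- `M` makes the contribution of large values at most half of `(c^P)⁻¹`; then `n` makes that of
  -- the support at most the other half.
  obtain ⟨M, hM1, hM⟩ : ∃ M : ℝ, 1 ≤ M ∧ M ^ (-a) ≤ (c ^ P)⁻¹ / 2 := by
    have h1 := (tendsto_rpow_neg_atTop ha).eventually_le_const
      (show 0 < (c ^ P)⁻¹ / 2 by positivity)
    exact ((eventually_ge_atTop 1).and h1).exists
  have hMP : 0 < M ^ P := Real.rpow_pos_of_pos (by linarith) P
  obtain ⟨n, hn⟩ := (hA0.eventually_le_const
    (show 0 < ENNReal.ofReal ((M ^ P)⁻¹ * ((c ^ P)⁻¹ / 2)) by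
      rw [ENNReal.ofReal_pos]; positivity)).exists
  have h1 := (modular_le_of_norm_lt (f := f n) (r := 2) (by rw [hf1 n]; norm_num)).2
  have h2 := modular_le_of_gap (μ := μ) ha.le hP hgap hM1 (f := fun t => (f n).1 t / 2)
    ((AEEqFun.measurable _).div_const 2)
  have hAn : {t | (f n).1 t / 2 ≠ 0} = A n := by ext t; simp [A]
  rw [hAn] at h2
  have h3 : modular q μ (fun t => (f n).1 t / 2) ≤ ENNReal.ofReal (c ^ P)⁻¹ := by
    calc _ ≤ ENNReal.ofReal (M ^ (-a)) * modular p μ (fun t => (f n).1 t / 2)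
          + ENNReal.ofReal (M ^ P) * μ (A n) := h2
      _ ≤ ENNReal.ofReal ((c ^ P)⁻¹ / 2) * 1
          + ENNReal.ofReal (M ^ P) * ENNReal.ofReal ((M ^ P)⁻¹ * ((c ^ P)⁻¹ / 2)) := by gcongr
      _ = ENNReal.ofReal (c ^ P)⁻¹ := by
        rw [mul_one, ← ENNReal.ofReal_mul hMP.le, mul_inv_cancel_left₀ hMP.ne',
          ← ENNReal.ofReal_add (by positivity) (by positivity), add_halves]
  have h4 := modular_const_mul_le_rpow (μ := μ) hP hc1 (fun t => (f n).1 t / 2)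
  have h5 : ‖inclusion hqp (f n)‖ ≤ 2 / c := by
    refine norm_le_of_modular (by positivity) ?_
    have e : (fun t => (inclusion hqp (f n)).1 t / (2 / c)) = fun t => c * ((f n).1 t / 2) := by
      funext t
      change (f n).1 t / (2 / c) = _
      field_simp
    rw [e]
    refine h4.trans ((mul_le_mul_right h3 _).trans ?_)
    rw [← ENNReal.ofReal_mul hcP.le, mul_inv_cancel₀ hcP.ne', ENNReal.ofReal_one]
  have h6 := (hlow n).trans (mul_le_mul_of_nonneg_left h5 hK.le)
  rw [← mul_div_assoc, le_div_iff₀ (by linarith)] at h6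
  linarith

end VarLebesgue

/-! ### Height and mass of normalized indicators -/

namespace VarLebesgue

section NormalizedIndicator

variable {Ω : Type*} [MeasurableSpace Ω] {p q : Exponent Ω} {μ : Measure Ω}

theorem modular_congr {f g : Ω → ℝ} (h : ∀ᵐ t ∂μ, f t = g t) : modular p μ f = modular p μ g :=
  lintegral_congr_ae (h.mono fun t ht => by simp only [ht])

theorem modular_indicator {J : Set Ω} (hJ : MeasurableSet J) {c : ℝ} (hc : 0 ≤ c) :
    modular p μ (J.indicator fun _ => c) = ∫⁻ t in J, ENNReal.ofReal (c ^ p t) ∂μ := by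
  rw [← lintegral_indicator hJ]
  refine lintegral_congr fun t => ?_
  by_cases ht : t ∈ J
  · rw [indicator_of_mem ht, indicator_of_mem ht, enorm_rpow_eq_ofReal _ (exponent_pos p t).le,
      abs_of_nonneg hc]
  · rw [indicator_of_notMem ht, indicator_of_notMem ht, enorm_zero,
      ENNReal.zero_rpow_of_pos (exponent_pos p t)]

theorem exists_normalized_indicator [IsFiniteMeasure μ] (p : Exponent Ω) {J : Set Ω}
    (hJ : MeasurableSet J) (hμ : μ J ≠ 0) :
    ∃ (c : ℝ) (f : VLp p μ), 0 < c ∧ ‖f‖ = 1 ∧ ∀ᵐ t ∂μ, f.1 t = J.indicator (fun _ => c) t := by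
  have hu : AEStronglyMeasurable (J.indicator fun _ => (1 : ℝ)) μ :=
    (measurable_const.indicator hJ).aestronglyMeasurable
  have hmem : AEEqFun.mk _ hu ∈ VLp p μ := by
    refine ⟨1, one_pos, ?_⟩
    rw [modular_congr (g := J.indicator fun _ => (1 : ℝ))
      ((AEEqFun.coeFn_mk _ hu).mono fun t ht => by rw [ht, div_one]),
      modular_indicator hJ zero_le_one]
    simp [measure_lt_top μ J]
  let u : VLp p μ := ⟨_, hmem⟩
  have hu1 : ∀ᵐ t ∂μ, u.1 t = J.indicator (fun _ => (1 : ℝ)) t := AEEqFun.coeFn_mk _ hu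
  have hz : ∀ᵐ t ∂μ, (0 : VLp p μ).1 t = 0 := AEEqFun.coeFn_zero
  have hne : u ≠ 0 := by
    intro h0
    refine hμ (measure_mono_null (t := {t | ¬ (J.indicator (fun _ => (1 : ℝ)) t = 0)})
      (fun t ht => ?_) (ae_iff.1 ?_))
    · simp [ht]
    · filter_upwards [hu1, hz] with t h1 h2
      rw [← h1, h0, h2]
  have hpos : 0 < ‖u‖ := norm_pos_iff.2 hne
  refine ⟨‖u‖⁻¹, ‖u‖⁻¹ • u, inv_pos.2 hpos, ?_, ?_⟩
  · rw [norm_smul, norm_inv, norm_norm, inv_mul_cancel₀ hpos.ne']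
  · filter_upwards [hu1, AEEqFun.coeFn_smul ‖u‖⁻¹ u.1] with t h1 h2
    have h2' : (‖u‖⁻¹ • u).1 t = ‖u‖⁻¹ * u.1 t := h2
    rw [h2', h1]
    by_cases ht : t ∈ J <;> simp [ht]

variable {J : Set Ω} {c : ℝ} {f : VLp p μ}

/-- If `c ≥ 2`, then `(c/2)^p ≥ c/2` because `p ≥ 1`, and the modular of `f/2` is at most `1`, so
`(c/2) m ≤ 1`. If `c ≤ 2`, use `m ≤ 1`. -/
theorem height_le_of_norm_eq_one (hJ : MeasurableSet J) (hc : 0 < c) (hf1 : ‖f‖ = 1)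
    (hf : ∀ᵐ t ∂μ, f.1 t = J.indicator (fun _ => c) t) {m : ℝ} (hm0 : 0 < m) (hm1 : m ≤ 1)
    (hm : ENNReal.ofReal m ≤ μ J) : c ≤ 2 / m := by
  rcases le_total c 2 with h | h
  · exact h.trans ((le_div_iff₀ hm0).2 (by linarith))
  have h1 := (modular_le_of_norm_lt (f := f) (r := 2) (by rw [hf1]; norm_num)).2
  rw [modular_congr (g := J.indicator fun _ => c / 2) (hf.mono fun t ht => by
      rw [ht]; by_cases h : t ∈ J <;> simp [h]), modular_indicator hJ (by positivity)] at h1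
  have h2 : ENNReal.ofReal (c / 2 * m) ≤ 1 := by
    refine le_trans ?_ h1
    calc ENNReal.ofReal (c / 2 * m) ≤ ENNReal.ofReal (c / 2) * μ J := by
          rw [ENNReal.ofReal_mul (by positivity)]; gcongr
      _ = ∫⁻ _ in J, ENNReal.ofReal (c / 2) ∂μ := (setLIntegral_const _ _).symm
      _ ≤ _ := lintegral_mono fun t => ENNReal.ofReal_le_ofReal
          (Real.self_le_rpow_of_one_le (by linarith) (p.one_le' t))
  rw [ENNReal.ofReal_le_one] at h2
  rw [le_div_iff₀ hm0]
  linarith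

/-- Otherwise the `p`-modular of `2f` would be at most `1`, giving `‖f‖ ≤ 1/2`. -/
theorem one_le_mul_lintegral_of_norm_eq_one (hJ : MeasurableSet J) (hc : 0 < c)
    (hf1 : ‖f‖ = 1) (hf : ∀ᵐ t ∂μ, f.1 t = J.indicator (fun _ => c) t) {P K : ℝ} (hK : 0 ≤ K)
    (hP : ∀ t, p t ≤ P) (hcK : ∀ t ∈ J, c ^ p t ≤ K * c ^ q t) :
    1 ≤ ENNReal.ofReal (2 ^ P * K) * ∫⁻ t in J, ENNReal.ofReal (c ^ q t) ∂μ := by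
  by_contra! hlt
  have h1 : modular p μ (fun t => f.1 t / (1 / 2)) ≤ 1 := by
    rw [modular_congr (g := J.indicator fun _ => 2 * c) (hf.mono fun t ht => by
      rw [ht]; by_cases h : t ∈ J <;> simp [h, mul_comm]), modular_indicator hJ (by positivity)]
    refine le_trans ?_ hlt.le
    rw [← lintegral_const_mul' _ _ ENNReal.ofReal_ne_top]
    refine setLIntegral_mono' hJ fun t ht => ?_
    rw [← ENNReal.ofReal_mul (by positivity)]
    refine ENNReal.ofReal_le_ofReal ?_
    rw [Real.mul_rpow zero_le_two hc.le, mul_assoc]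
    gcongr
    · norm_num
    · exact hP t
    · exact hcK t ht
  have h2 := norm_le_of_modular (by norm_num) h1
  rw [hf1] at h2
  norm_num at h2

end NormalizedIndicator

/-! ### Spans of disjoint indicators -/

section Shells

variable {Ω : Type*} [MeasurableSpace Ω] {p q : Exponent Ω} {μ : Measure Ω}

/-- Only the pointwise shape is recorded, which the modular estimates need; finiteness of the
combination plays no role. -/
theorem exists_coeff_of_mem_span {J : ℕ → Set Ω} {c : ℕ → ℝ}
    (hJd : Pairwise (Function.onFun Disjoint J)) {f : ℕ → VLp p μ}
    (hf : ∀ n, ∀ᵐ t ∂μ, (f n).1 t = (J n).indicator (fun _ => c n) t) {g : VLp p μ}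
    (hg : g ∈ Submodule.span ℝ (range f)) :
    ∃ a : ℕ → ℝ, (∀ᵐ t ∂μ, ∀ n, t ∈ J n → g.1 t = a n * c n) ∧
      ∀ᵐ t ∂μ, (∀ n, t ∉ J n) → g.1 t = 0 := by
  induction hg using Submodule.span_induction with
  | mem x hx =>
    obtain ⟨k, rfl⟩ := hx
    refine ⟨fun n => if n = k then 1 else 0, ?_, ?_⟩
    · filter_upwards [hf k] with t ht n hn
      rw [ht]
      rcases eq_or_ne n k with rfl | hnk
      · simp [hn]
      · have : t ∉ J k := disjoint_left.1 (hJd hnk) hn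
        simp [this, hnk]
    · filter_upwards [hf k] with t ht hn
      rw [ht, indicator_of_notMem (hn k)]
  | zero =>
    have hz : ∀ᵐ t ∂μ, (0 : VLp p μ).1 t = 0 := AEEqFun.coeFn_zero
    exact ⟨0, hz.mono fun t ht n _ => by rw [ht, Pi.zero_apply, zero_mul], hz.mono fun t ht _ => ht⟩
  | add x y _ _ hx hy =>
    obtain ⟨a, hx1, hx0⟩ := hx
    obtain ⟨b, hy1, hy0⟩ := hy
    have hadd : ∀ᵐ t ∂μ, (x + y).1 t = x.1 t + y.1 t := AEEqFun.coeFn_add x.1 y.1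
    refine ⟨a + b, ?_, ?_⟩
    · filter_upwards [hx1, hy1, hadd] with t h1 h2 h3 n hn
      rw [h3, h1 n hn, h2 n hn, Pi.add_apply, add_mul]
    · filter_upwards [hx0, hy0, hadd] with t h1 h2 h3 hn
      rw [h3, h1 hn, h2 hn, add_zero]
  | smul k x _ hx =>
    obtain ⟨a, hx1, hx0⟩ := hx
    have hsmul : ∀ᵐ t ∂μ, (k • x).1 t = k * x.1 t := AEEqFun.coeFn_smul k x.1
    refine ⟨k • a, ?_, ?_⟩
    · filter_upwards [hx1, hsmul] with t h1 h3 n hn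
      rw [h3, h1 n hn, Pi.smul_apply, smul_eq_mul, mul_assoc]
    · filter_upwards [hx0, hsmul] with t h1 h3 hn
      rw [h3, h1 hn, mul_zero]

variable [IsFiniteMeasure μ]

/-- If `g = ∑ aₙ cₙ 1_{Jₙ}` where the functions `cₙ 1_{Jₙ}` have comparable `p`- and
`q`-modulars that are bounded below, then the norm of `g` in `L^p` is dominated by that in
`L^q`. -/
theorem norm_le_norm_inclusion_of_eq_on (hqp : ∀ᵐ t ∂μ, q t ≤ p t) {J : ℕ → Set Ω} {c a : ℕ → ℝ}
    {K B : ℝ} (hJ : ∀ n, MeasurableSet (J n)) (hc : ∀ n, 0 < c n) (hK : 0 ≤ K) (hB : 1 ≤ B)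
    (hKB : K ≤ B) (hcK : ∀ n, ∀ t ∈ J n, c n ^ p t ≤ K * c n ^ q t)
    (hlow : ∀ n, 1 ≤ ENNReal.ofReal B * ∫⁻ t in J n, ENNReal.ofReal (c n ^ q t) ∂μ)
    {g : VLp p μ} (hgJ : ∀ᵐ t ∂μ, ∀ n, t ∈ J n → g.1 t = a n * c n)
    (hg0 : ∀ᵐ t ∂μ, (∀ n, t ∉ J n) → g.1 t = 0) :
    ‖g‖ ≤ B * ‖inclusion hqp g‖ := by
  have hB0 : 0 < B := by linarith
  rw [← div_le_iff₀' hB0]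
  refine le_of_forall_gt fun r hr => ?_
  obtain ⟨s, hs, hsr⟩ := exists_between hr
  refine lt_of_le_of_lt ?_ hsr
  obtain ⟨hs0, hs1⟩ := modular_le_of_norm_lt hs
  change modular q μ (fun t => g.1 t / s) ≤ 1 at hs1
  -- A larger coefficient would exceed `1`, so raising it to the power `q ≥ 1` does not shrink it.
  -- The set `J n` alone would then give a `q`-modular above `1`.
  have hcoef : ∀ n, |a n| / s ≤ B := by
    intro n
    by_contra! hlt
    have h1 : ENNReal.ofReal (|a n| / s) * ∫⁻ t in J n, ENNReal.ofReal (c n ^ q t) ∂μ ≤ 1 := by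
      refine le_trans ?_ hs1
      rw [← lintegral_const_mul' _ _ ENNReal.ofReal_ne_top]
      refine le_trans ?_ (setLIntegral_le_lintegral (J n) _)
      refine lintegral_mono_ae ?_
      filter_upwards [ae_restrict_of_ae hgJ, ae_restrict_mem (hJ n)] with t ht htJ
      rw [ht n htJ, enorm_rpow_eq_ofReal _ (exponent_pos q t).le,
        ← ENNReal.ofReal_mul (by positivity)]
      refine ENNReal.ofReal_le_ofReal ?_
      have e : |a n * c n / s| = |a n| / s * c n := by
        rw [abs_div, abs_mul, abs_of_pos (hc n), abs_of_pos hs0]; ring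
      rw [e, Real.mul_rpow (by positivity) (hc n).le]
      have := Real.rpow_nonneg (hc n).le (q t)
      gcongr
      exact Real.self_le_rpow_of_one_le (by linarith) (q.one_le' t)
    set I := ∫⁻ t in J n, ENNReal.ofReal (c n ^ q t) ∂μ
    have hI0 : I ≠ 0 := fun h => by simpa [I, h] using hlow n
    have hIt : I ≠ ∞ := fun h => by
      rw [h, ENNReal.mul_top (by rw [Ne, ENNReal.ofReal_eq_zero]; linarith)] at h1
      exact absurd h1 (by simp)
    have h2 : ENNReal.ofReal B * I < ENNReal.ofReal (|a n| / s) * I :=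
      (ENNReal.mul_lt_mul_iff_left hI0 hIt).2 ((ENNReal.ofReal_lt_ofReal_iff (by linarith)).2 hlt)
    exact absurd ((hlow n).trans_lt h2) h1.not_gt
  rw [div_le_iff₀' hB0]
  refine norm_le_of_modular (by positivity) ?_
  -- After division by `B` the coefficients are at most `1`, so their `p`-th powers are below their
  -- `q`-th powers; `hcK` handles the heights.
  have hpq : modular p μ (fun t => g.1 t / (B * s))
      ≤ ENNReal.ofReal K * modular q μ (fun t => B⁻¹ * (g.1 t / s)) := by
    unfold modular
    rw [← lintegral_const_mul' _ _ ENNReal.ofReal_ne_top]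
    refine lintegral_mono_ae ?_
    filter_upwards [hgJ, hg0, hqp] with t h1 h2 h3
    by_cases h : ∃ n, t ∈ J n
    · obtain ⟨n, hn⟩ := h
      have e1 : |a n * c n / (B * s)| = |a n| / s / B * c n := by
        rw [abs_div, abs_mul, abs_of_pos (hc n), abs_of_pos (mul_pos hB0 hs0)]; field_simp
      have e2 : |B⁻¹ * (a n * c n / s)| = |a n| / s / B * c n := by
        rw [← e1]; congr 1; field_simp
      have hb : |a n| / s / B ≤ 1 := (div_le_one hB0).2 (hcoef n)
      have hb0 : 0 ≤ |a n| / s / B := by positivity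
      rw [h1 n hn, enorm_rpow_eq_ofReal _ (exponent_pos q t).le,
        enorm_rpow_eq_ofReal _ (exponent_pos p t).le, ← ENNReal.ofReal_mul hK, e1, e2]
      refine ENNReal.ofReal_le_ofReal ?_
      rw [Real.mul_rpow hb0 (hc n).le, Real.mul_rpow hb0 (hc n).le, mul_left_comm]
      have h4 := hcK n t hn
      have h5 : (|a n| / s / B) ^ p t ≤ (|a n| / s / B) ^ q t :=
        Real.rpow_le_rpow_of_exponent_ge_of_imp hb0 hb h3 fun _ h => absurd h (exponent_pos p t).ne'
      have h6 := Real.rpow_nonneg (hc n).le (p t)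
      gcongr
    · rw [h2 (not_exists.1 h), zero_div, enorm_zero, ENNReal.zero_rpow_of_pos (exponent_pos p t)]
      exact zero_le
  refine hpq.trans ?_
  -- Since `q ≥ 1`, the scalar `B⁻¹` leaves the modular as a factor of at most `B⁻¹`, which absorbs
  -- `K ≤ B`.
  have h1 := modular_const_mul_le (p := q) (μ := μ) (f := fun t => g.1 t / s)
    (g.1.aestronglyMeasurable.div₀ aestronglyMeasurable_const) (c := B⁻¹) (by positivity)
    (inv_le_one_of_one_le₀ hB)
  calc _ ≤ ENNReal.ofReal B * (ENNReal.ofReal B⁻¹ * 1) := by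
        gcongr
        exact h1.trans (by gcongr)
    _ = 1 := by
        rw [mul_one, ← ENNReal.ofReal_mul hB0.le, mul_inv_cancel₀ hB0.ne', ENNReal.ofReal_one]

theorem inclusion_injective (hqp : ∀ᵐ t ∂μ, q t ≤ p t) : Function.Injective (inclusion hqp) :=
  fun _ _ h => Subtype.ext (congrArg (fun x : VLp q μ => x.1) h)

/-- If there are disjoint sets `Jₙ` of measure at least `mₙ` on which `(2 / mₙ) ^ (p - q)` is
bounded, then the inclusion `L^p ↪ L^q` is an isomorphism on the closed span of their normalized
indicator functions. -/
theorem not_disjointlyStrictlySingular_inclusion (hqp : ∀ᵐ t ∂μ, q t ≤ p t) {P K : ℝ}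
    (hP : ∀ t, p t ≤ P) (hK : 1 ≤ K) (hd : ∀ t, q t ≤ p t) {J : ℕ → Set Ω} {m : ℕ → ℝ}
    (hJ : ∀ n, MeasurableSet (J n)) (hJd : Pairwise (Function.onFun Disjoint J))
    (hm0 : ∀ n, 0 < m n) (hm1 : ∀ n, m n ≤ 1) (hm : ∀ n, ENNReal.ofReal (m n) ≤ μ (J n))
    (hmK : ∀ n, ∀ t ∈ J n, (2 / m n) ^ (p t - q t) ≤ K) :
    ¬ DisjointlyStrictlySingular (inclusion hqp) := by
  have hμ : ∀ n, μ (J n) ≠ 0 := fun n =>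
    ((ENNReal.ofReal_pos.2 (hm0 n)).trans_le (hm n)).ne'
  choose c f hc hf1 hf using fun n => exists_normalized_indicator p (hJ n) (hμ n)
  have hcK : ∀ n, ∀ t ∈ J n, c n ^ p t ≤ K * c n ^ q t := by
    intro n t ht
    have h1 : c n ^ (p t - q t) ≤ K :=
      (Real.rpow_le_rpow (hc n).le
        (height_le_of_norm_eq_one (hJ n) (hc n) (hf1 n) (hf n) (hm0 n) (hm1 n) (hm n))
        (sub_nonneg.2 (hd t))).trans (hmK n t ht)
    rw [← sub_add_cancel (p t) (q t), Real.rpow_add (hc n)]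
    have := Real.rpow_nonneg (hc n).le (q t)
    gcongr
  intro hdss
  refine hdss f hf1 (fun k n hkn => abs_inf_abs_eq_zero_iff.2 ?_)
    -- The constant `2 ^ P * K` serves as both the bound from below on the masses and an upper bound
    -- for `K`.
    (isIsomorphismOn_closure_of_norm_le (inclusion_injective hqp) (K := 2 ^ P * K) fun g hg => ?_)
  · filter_upwards [hf k, hf n] with t h1 h2
    rw [h1, h2]
    by_cases ht : t ∈ J k
    · exact Or.inr (indicator_of_notMem (disjoint_left.1 (hJd hkn) ht) _)
    · exact Or.inl (indicator_of_notMem ht _)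
  · obtain ⟨a, hg1, hg0⟩ := exists_coeff_of_mem_span hJd hf hg
    -- A point of `Ω` is needed to get `P ≥ 0`, hence `2 ^ P ≥ 1`.
    have hne : Nonempty Ω := by
      by_contra h
      rw [not_nonempty_iff] at h
      exact hμ 0 (by simp [Measure.eq_zero_of_isEmpty])
    have hP0 : 0 ≤ P := (exponent_pos p hne.some).le.trans (hP _)
    have h2P : (1 : ℝ) ≤ 2 ^ P := Real.one_le_rpow one_le_two hP0
    exact norm_le_norm_inclusion_of_eq_on hqp hJ hc (by linarith)
      (one_le_mul_of_one_le_of_one_le h2P hK) (le_mul_of_one_le_left (by linarith) h2P) hcK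
      (fun n => one_le_mul_lintegral_of_norm_eq_one (hJ n) (hc n) (hf1 n) (hf n) (by linarith)
        hP (hcK n)) hg1 hg0

end Shells

/-! ### Dyadic shells around a zero of the difference -/

/-- The shell of outer radius `h ≤ 1/2` has measure at least `m = h/2`, so `2/m = 4/h` and `ln (4/h)
≤ 3 ln (1/h)`. Since `(p - q) ln (1/h) ≤ C` there, `(2/m)^(p - q) ≤ exp (3C)` on every shell. -/
theorem not_disjointlyStrictlySingular_inclusion_of_eq {p q : Exponent unitInterval}
    (hqp : ∀ᵐ t ∂(volume : Measure unitInterval), q t ≤ p t) {P : ℝ} (hP : ∀ t, p t ≤ P)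
    (hd : ∀ t, q t ≤ p t) (hlog : LogHolderContinuous fun t => p t - q t) {t₀ : unitInterval}
    (h0 : p t₀ - q t₀ = 0) : ¬ DisjointlyStrictlySingular (inclusion hqp) := by
  obtain ⟨C, hC, hlog⟩ := hlog.exists_abs_sub_mul_log_le
  -- The shift `n + 1` keeps every radius at most `1/2`, as the measure bound requires.
  let h : ℕ → ℝ := fun n => (1 / 2) ^ (n + 1)
  have hpos : ∀ n, 0 < h n := fun n => by positivity
  have hsucc : ∀ n, h (n + 1) = h n / 2 := fun n => by simp only [h]; ring
  have hanti : Antitone h := fun m n hmn =>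
    pow_le_pow_of_le_one (by norm_num) (by norm_num) (by omega)
  have hhalf : ∀ n, h n ≤ 1 / 2 := fun n => (hanti (Nat.zero_le n)).trans (by norm_num [h])
  have hdist : Measurable fun t : unitInterval => dist t t₀ := measurable_id.dist measurable_const
  refine not_disjointlyStrictlySingular_inclusion hqp hP (K := Real.exp (3 * C))
    (Real.one_le_exp (by positivity)) hd
    (J := fun n => {t | h (n + 1) < dist t t₀ ∧ dist t t₀ ≤ h n}) (m := fun n => h n / 2)
    (fun n => (measurableSet_lt measurable_const hdist).inter
      (measurableSet_le hdist measurable_const)) ?_ (fun n => half_pos (hpos n))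
    (fun n => by linarith [hhalf n]) (fun n => ?_) (fun n t ht => ?_)
  · refine (pairwise_disjoint_on _).2 fun m n hmn => ?_
    refine disjoint_left.2 fun t hm hn => ?_
    have h1 : h (m + 1) < dist t t₀ := hm.1
    have h2 : dist t t₀ ≤ h n := hn.2
    exact absurd (h1.trans_le h2) (hanti (Nat.succ_le_of_lt hmn)).not_gt
  · have hv := unitInterval.ofReal_sub_le_volume_shell t₀ (hpos (n + 1)).le
      (hanti n.le_succ) (hhalf n)
    rwa [show h n - h (n + 1) = h n / 2 by rw [hsucc]; ring] at hv
  · have h1 := hlog t t₀ (h n) (hpos n) ht.2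
    simp only [h0, sub_zero] at h1
    rw [abs_of_nonneg (sub_nonneg.2 (hd t))] at h1
    have hl2 : Real.log 2 ≤ Real.log (1 / h n) := by
      refine Real.log_le_log two_pos ((le_div_iff₀ (hpos n)).2 ?_)
      linarith [hhalf n]
    have e : 2 / (h n / 2) = 2 * 2 * (1 / h n) := by field_simp
    have hlog4 : Real.log (2 / (h n / 2)) ≤ 3 * Real.log (1 / h n) := by
      have : (1 / h n) ≠ 0 := (one_div_pos.2 (hpos n)).ne'
      rw [e, Real.log_mul (by norm_num) this, Real.log_mul two_ne_zero two_ne_zero]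
      linarith
    rw [Real.rpow_def_of_pos (div_pos two_pos (half_pos (hpos n)))]
    refine Real.exp_le_exp.2 ?_
    calc _ ≤ 3 * Real.log (1 / h n) * (p t - q t) :=
          mul_le_mul_of_nonneg_right hlog4 (sub_nonneg.2 (hd t))
      _ ≤ 3 * C := by linarith

end VarLebesgue

/-! ### The equivalence -/

theorem corollary5p3 (p q : Exponent unitInterval)
    (hp : LogHolderContinuous p) (hq : LogHolderContinuous q)
    (hqp : ∀ᵐ t ∂(volume : Measure unitInterval), q t ≤ p t)
    (hp_bdd : essSup (fun t => ENNReal.ofReal (p t)) (volume : Measure unitInterval) < ∞) :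
    List.TFAE [
      0 < essInf (fun t => p t - q t) (volume : Measure unitInterval),
      DisjointlyStrictlySingular (VarLebesgue.inclusion hqp),
      Tendsto (fun x : ℝ => (1 - x) ^
          decreasingRearrangement (volume : Measure unitInterval) (fun t => p t - q t) x)
        (𝓝[<] 1) (𝓝 0)] := by
  have hlog := hp.sub hq
  have hbdd : ∀ {f : unitInterval → ℝ}, Continuous f → ∃ B, ∀ t, |f t| ≤ B := fun hf => by
    obtain ⟨B, hB⟩ := isCompact_univ.exists_bound_of_continuousOn hf.continuousOn
    exact ⟨B, fun t => hB t (mem_univ t)⟩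
  obtain ⟨B, hB⟩ := hbdd hlog.continuous
  obtain ⟨P, hP⟩ := hbdd hp.continuous
  obtain ⟨Q, hQ⟩ := hbdd hq.continuous
  rcases exists_eq_zero_or_gap hlog.continuous (hqp.mono fun t ht => sub_nonneg.2 ht) with
    ⟨t₀, h0⟩ | ⟨a, ha, hgap⟩
  · have hd := forall_le_of_ae_le hq.continuous hp.continuous hqp
    have n1 : ¬ 0 < essInf (fun t => p t - q t) (volume : Measure unitInterval) := by
      rw [essInf_pos_iff hB]
      rintro ⟨a, ha, h⟩
      have h1 := forall_le_of_ae_le continuous_const hlog.continuous h t₀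
      linarith
    have n2 := VarLebesgue.not_disjointlyStrictlySingular_inclusion_of_eq hqp
      (fun t => le_of_abs_le (hP t)) hd hlog h0
    have n3 := not_tendsto_one_sub_rpow_of_zero hlog h0
    -- All three conditions fail at a zero of `p - q`, so the cycle holds vacuously.
    tfae_have 1 → 2 := fun h => absurd h n1
    tfae_have 2 → 3 := fun h => absurd h n2
    tfae_have 3 → 1 := fun h => absurd h n3
    tfae_finish
  · have h1 : 0 < essInf (fun t => p t - q t) (volume : Measure unitInterval) :=
      (essInf_pos_iff hB).2 ⟨a, ha, Eventually.of_forall hgap⟩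
    have h2 := VarLebesgue.disjointlyStrictlySingular_inclusion_of_gap hqp ha
      (fun t => le_of_abs_le (hQ t)) (Eventually.of_forall fun t => by linarith [hgap t])
    have h3 := tendsto_one_sub_rpow_of_gap (μ := (volume : Measure unitInterval)) ha hB
      (Eventually.of_forall fun t => (hgap t).trans (le_abs_self _))
    tfae_have 1 → 2 := fun _ => h2
    tfae_have 2 → 3 := fun _ => h3
    tfae_have 3 → 1 := fun _ => h1
    tfae_finish
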